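/- Let $r>0$ and consider the distributed delay differential equation $$x'(t)=-\int_0^1 r\sin\bigl(x(t-s)\bigr)\,ds,\qquad t\in\mathbb R. \tag{1}$$ A special symmetric periodic solution (SSPS) of (1) is a solution $x:\mathbb R\to\mathbb R$ which is periodic with minimal period $2$ and satisfies $x(t)+x(t-1)=0$ for all $t\in\mathbb R$. For $0\le k<1$ let $F(\varphi,k)=\int_0^{\varphi}\frac{d\theta}{\sqrt{1-k^2\sin^2\theta}}$, let $K(k)=F(\pi/2,k)$ be the complete elliptic integral of the first kind, and let $\operatorname{sn}(u,k)=\sin\varphi$, where $\varphi\in\mathbb R$ is the unique number with $F(\varphi,k)=u$, be the Jacobi elliptic sine with modulus $k$. Equation (1) has an SSPS if and only if $r>\pi^2/2$. If $r>\pi^2/2$, then the equation $$\frac{2K(\sqrt a)}{\sqrt{2r}}=1$$ has a unique solution $a\in(0,1)$, the function $$x(t)=2\arcsin\bigl(\sqrt a\,\operatorname{sn}(\sqrt{2r}\,t,\sqrt a)\bigr),\qquad t\in\mathbb R,$$ is an SSPS of (1), and every SSPS of (1) is of the form $t\mapsto x(t+t_0)$ for some $t_0\in\mathbb R$. -/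

import Mathlib

noncomputable section

/-- Incomplete elliptic integral of the first kind (Legendre form), amplitude `φ`, modulus `k`. -/
def ellipticF (φ k : ℝ) : ℝ :=
  ∫ θ in (0 : ℝ)..φ, 1 / Real.sqrt (1 - k ^ 2 * Real.sin θ ^ 2)

/-- Complete elliptic integral of the first kind with modulus `k`. -/
def ellipticK (k : ℝ) : ℝ := ellipticF (Real.pi / 2) k

/-- Jacobi amplitude: the inverse of `φ ↦ ellipticF φ k`, which is a bijection of `ℝ` for
`k ^ 2 < 1` (see `ellipticF_jacobiAm`, `jacobiAm_ellipticF`). -/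
def jacobiAm (u k : ℝ) : ℝ := Function.invFun (fun φ => ellipticF φ k) u

/-- Jacobi elliptic sine with argument `u` and modulus `k`. -/
def jacobiSn (u k : ℝ) : ℝ := Real.sin (jacobiAm u k)

/-- `x : ℝ → ℝ` solves `x'(t) = -∫₀¹ f (x (t - s)) ds` on the whole line. -/
def IsSolutionDDE (f x : ℝ → ℝ) : Prop :=
  ∀ t : ℝ, HasDerivAt x (-∫ s in (0 : ℝ)..1, f (x (t - s))) t

/-- Special symmetric periodic solution: a solution with minimal period `2` such that
`x(t) + x(t - 1) = 0` for all `t`. -/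
structure IsSSPS (f x : ℝ → ℝ) : Prop where
  isSolution : IsSolutionDDE f x
  minimalPeriod : IsLeast {T : ℝ | 0 < T ∧ Function.Periodic x T} 2
  symmetric : ∀ t : ℝ, x t + x (t - 1) = 0

theorem ellipticF_bijective {k : ℝ} (hk : k ^ 2 < 1) :
    Function.Bijective (fun φ => ellipticF φ k) := by
  have hpos : ∀ θ : ℝ, 0 < 1 - k ^ 2 * Real.sin θ ^ 2 := fun θ => by
    nlinarith [Real.sin_sq_le_one θ, sq_nonneg (Real.sin θ), sq_nonneg k]
  have hc : Continuous fun θ : ℝ => 1 / Real.sqrt (1 - k ^ 2 * Real.sin θ ^ 2) := by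
    refine continuous_const.div (by fun_prop) fun θ => ?_
    exact (Real.sqrt_pos.2 (hpos θ)).ne'
  have hge : ∀ θ : ℝ, 1 ≤ 1 / Real.sqrt (1 - k ^ 2 * Real.sin θ ^ 2) := fun θ => by
    rw [le_div_iff₀ (Real.sqrt_pos.2 (hpos θ)), one_mul]
    exact Real.sqrt_le_one.2 (by nlinarith [mul_nonneg (sq_nonneg k) (sq_nonneg (Real.sin θ))])
  have hexp : ∀ a b : ℝ, a ≤ b → b - a ≤ ellipticF b k - ellipticF a k := fun a b hab => by
    unfold ellipticF
    rw [intervalIntegral.integral_interval_sub_left (hc.intervalIntegrable _ _)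
      (hc.intervalIntegrable _ _)]
    have h := intervalIntegral.integral_mono_on (μ := MeasureTheory.volume) hab
      ((continuous_const (y := (1 : ℝ))).intervalIntegrable a b)
      (hc.intervalIntegrable a b) (fun θ _ => hge θ)
    simpa using h
  have h0 : ellipticF 0 k = 0 := by simp [ellipticF]
  have hcont : Continuous fun φ => ellipticF φ k :=
    intervalIntegral.continuous_primitive (fun a b => hc.intervalIntegrable a b) 0
  refine ⟨StrictMono.injective fun a b hab => ?_, hcont.surjective ?_ ?_⟩
  · have := hexp a b hab.le
    show ellipticF a k < ellipticF b k
    linarith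
  · refine Filter.tendsto_atTop_mono' _ ?_ Filter.tendsto_id
    filter_upwards [Filter.eventually_ge_atTop 0] with φ hφ
    have := hexp 0 φ hφ
    simp only [id]
    linarith
  · refine Filter.tendsto_atBot_mono' _ ?_ Filter.tendsto_id
    filter_upwards [Filter.eventually_le_atBot 0] with φ hφ
    have := hexp φ 0 hφ
    simp only [id]
    linarith

theorem ellipticF_jacobiAm {k : ℝ} (hk : k ^ 2 < 1) (u : ℝ) :
    ellipticF (jacobiAm u k) k = u :=
  Function.rightInverse_invFun (ellipticF_bijective hk).2 u

theorem jacobiAm_ellipticF {k : ℝ} (hk : k ^ 2 < 1) (φ : ℝ) :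
    jacobiAm (ellipticF φ k) k = φ :=
  Function.leftInverse_invFun (ellipticF_bijective hk).1 φ

end

/-!
Put `v = x'`. For odd `f` and `x (t + 1) = -x t`, the derivative of `-∫₀¹ f (x (t - s)) ds` is
`-(f (x t) - f (x (t - 1))) = -2 f (x t)`, so the delay equation becomes `x'' = -2 f(x)`; for
`f = r sin` this is the pendulum equation with frequency `ω = √(2r)`. A symmetric solution passes
through `0`, and conservation of energy at a turning point forces its speed there to be below `2ω`:
it is a libration, `2 arcsin (k sn (ωt, k))` up to a time shift. The minimal period of the libration
is `4K(k)/ω`, so everything reduces to `2K(k) = ω`, which has exactly one root `k ∈ (0, 1)` when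
`ω > π` and none otherwise, because `K` increases strictly from `π/2` to `∞`.
-/

open Real Set Filter Topology Function

section EllipticIntegrals

variable {k : ℝ}

theorem one_sub_sq_mul_sin_sq_pos (hk : k ^ 2 < 1) (θ : ℝ) : 0 < 1 - k ^ 2 * sin θ ^ 2 :=
  sub_pos.2 ((mul_le_of_le_one_right (sq_nonneg k) (sin_sq_le_one θ)).trans_lt hk)

theorem abs_mul_sin_lt_one (hk : k ^ 2 < 1) (θ : ℝ) : |k * sin θ| < 1 := by
  rw [← sq_lt_one_iff_abs_lt_one, mul_pow]
  exact sub_pos.1 (one_sub_sq_mul_sin_sq_pos hk θ)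

theorem continuous_ellipticIntegrand (hk : k ^ 2 < 1) :
    Continuous fun θ : ℝ => 1 / √(1 - k ^ 2 * sin θ ^ 2) :=
  continuous_const.div (by fun_prop) fun θ => (sqrt_pos.2 (one_sub_sq_mul_sin_sq_pos hk θ)).ne'

theorem hasDerivAt_ellipticF (hk : k ^ 2 < 1) (φ : ℝ) :
    HasDerivAt (fun φ => ellipticF φ k) (1 / √(1 - k ^ 2 * sin φ ^ 2)) φ :=
  ((continuous_ellipticIntegrand hk).integral_hasStrictDerivAt 0 φ).hasDerivAt

theorem strictMono_ellipticF (hk : k ^ 2 < 1) : StrictMono fun φ => ellipticF φ k :=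
  strictMono_of_hasDerivAt_pos (hasDerivAt_ellipticF hk) fun φ =>
    one_div_pos.2 (sqrt_pos.2 (one_sub_sq_mul_sin_sq_pos hk φ))

theorem ellipticF_zero (k : ℝ) : ellipticF 0 k = 0 := by simp [ellipticF]

theorem ellipticF_neg (φ k : ℝ) : ellipticF (-φ) k = -ellipticF φ k := by
  have h := intervalIntegral.integral_comp_neg (a := 0) (b := φ)
    fun θ => 1 / √(1 - k ^ 2 * sin θ ^ 2)
  simp only [sin_neg, neg_sq, neg_zero] at h
  rw [ellipticF, intervalIntegral.integral_symm, ← h, ellipticF]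

theorem ellipticF_add_int_mul_pi (hk : k ^ 2 < 1) (φ : ℝ) (n : ℤ) :
    ellipticF (φ + n * π) k = ellipticF φ k + n * (2 * ellipticK k) := by
  have hper : Periodic (fun θ => 1 / √(1 - k ^ 2 * sin θ ^ 2)) π := fun θ => by
    simp only [sin_add_pi, neg_sq]
  have hint := (continuous_ellipticIntegrand hk).intervalIntegrable (μ := MeasureTheory.volume)
  have hsub (a b : ℝ) : ∫ θ in a..b, 1 / √(1 - k ^ 2 * sin θ ^ 2) = ellipticF b k - ellipticF a k :=
    (intervalIntegral.integral_interval_sub_left (hint 0 b) (hint 0 a)).symm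
  have hperiods := hper.intervalIntegral_add_zsmul_eq n φ hint
  rw [hper.intervalIntegral_add_eq φ (-(π / 2)), hsub, hsub, zsmul_eq_mul, zsmul_eq_mul,
    show -(π / 2) + π = π / 2 by ring, ellipticF_neg] at hperiods
  rw [ellipticK]
  linear_combination hperiods

theorem ellipticK_pos (hk : k ^ 2 < 1) : 0 < ellipticK k := by
  simpa only [ellipticF_zero, ellipticK] using strictMono_ellipticF hk pi_div_two_pos

theorem ellipticK_zero : ellipticK 0 = π / 2 := by simp [ellipticK, ellipticF]

theorem strictMonoOn_ellipticK : StrictMonoOn ellipticK (Ico 0 1) := by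
  intro k hk l hl hkl
  have hk1 : k ^ 2 < 1 := (sq_lt_one_iff₀ hk.1).2 hk.2
  have hl1 : l ^ 2 < 1 := (sq_lt_one_iff₀ hl.1).2 hl.2
  have hsq : k ^ 2 < l ^ 2 := pow_lt_pow_left₀ hkl hk.1 two_ne_zero
  refine intervalIntegral.integral_lt_integral_of_continuousOn_of_le_of_exists_lt pi_div_two_pos
    (continuous_ellipticIntegrand hk1).continuousOn (continuous_ellipticIntegrand hl1).continuousOn
    (fun θ _ => ?_) ⟨π / 2, right_mem_Icc.2 pi_div_two_pos.le, ?_⟩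
  · have hpos := one_sub_sq_mul_sin_sq_pos hl1 θ
    gcongr
  · refine one_div_lt_one_div_of_lt (sqrt_pos.2 (one_sub_sq_mul_sin_sq_pos hl1 _))
      (sqrt_lt_sqrt (one_sub_sq_mul_sin_sq_pos hl1 _).le ?_)
    simpa using hsq

theorem continuousOn_ellipticK : ContinuousOn ellipticK {k | k ^ 2 < 1} := by
  rw [continuousOn_iff_continuous_domRestrict]
  have hc : Continuous (uncurry fun (k : {k : ℝ | k ^ 2 < 1}) (θ : ℝ) =>
      1 / √(1 - (k : ℝ) ^ 2 * sin θ ^ 2)) :=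
    continuous_const.div (by fun_prop) fun p =>
      (sqrt_pos.2 (one_sub_sq_mul_sin_sq_pos p.1.2 p.2)).ne'
  exact intervalIntegral.continuous_parametric_intervalIntegral_of_continuous'
    (μ := MeasureTheory.volume) hc 0 (π / 2)

theorem mul_cos_div_le_ellipticIntegrand (hk : k ^ 2 < 1) (θ : ℝ) :
    k * cos θ / (2 * (1 - k * sin θ)) ≤ 1 / √(1 - k ^ 2 * sin θ ^ 2) := by
  have hpos := one_sub_sq_mul_sin_sq_pos hk θ
  have hlt : k * sin θ < 1 := (abs_lt.1 (abs_mul_sin_lt_one hk θ)).2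
  have hsq := sq_sqrt hpos.le
  have hcos : k * cos θ ≤ √(1 - k ^ 2 * sin θ ^ 2) :=
    le_sqrt_of_sq_le (by rw [mul_pow, cos_sq']; linarith)
  rw [div_le_div_iff₀ (by linarith) (sqrt_pos.2 hpos), one_mul]
  calc k * cos θ * √(1 - k ^ 2 * sin θ ^ 2)
      ≤ √(1 - k ^ 2 * sin θ ^ 2) * √(1 - k ^ 2 * sin θ ^ 2) := by gcongr
    _ = (1 + k * sin θ) * (1 - k * sin θ) := by linear_combination hsq
    _ ≤ 2 * (1 - k * sin θ) := by gcongr; linarith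

theorem neg_log_one_sub_div_two_le_ellipticK (hk : k ^ 2 < 1) :
    -log (1 - k) / 2 ≤ ellipticK k := by
  have hpos (θ : ℝ) : 0 < 1 - k * sin θ := sub_pos.2 (abs_lt.1 (abs_mul_sin_lt_one hk θ)).2
  have hderiv (θ : ℝ) : HasDerivAt (fun θ => ellipticF θ k + log (1 - k * sin θ) / 2)
      (1 / √(1 - k ^ 2 * sin θ ^ 2) - k * cos θ / (2 * (1 - k * sin θ))) θ := by
    have hlog := (((hasDerivAt_sin θ).const_mul k).const_sub 1).log (hpos θ).ne'
    refine ((hasDerivAt_ellipticF hk θ).add (hlog.div_const 2)).congr_deriv ?_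
    have := (hpos θ).ne'
    field_simp
    ring
  have hmono : Monotone fun θ => ellipticF θ k + log (1 - k * sin θ) / 2 :=
    monotone_of_deriv_nonneg (fun θ => (hderiv θ).differentiableAt) fun θ => by
      rw [(hderiv θ).deriv, sub_nonneg]
      exact mul_cos_div_le_ellipticIntegrand hk θ
  have h := hmono pi_div_two_pos.le
  simp only [ellipticF_zero, sin_zero, mul_zero, sub_zero, log_one, zero_div, add_zero,
    sin_pi_div_two, mul_one] at h
  rw [ellipticK]
  linarith

theorem tendsto_ellipticK_atTop : Tendsto ellipticK (𝓝[<] 1) atTop := by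
  have hsub : Tendsto (fun k : ℝ => 1 - k) (𝓝[<] 1) (𝓝[>] 0) := by
    refine tendsto_nhdsWithin_iff.2
      ⟨?_, eventually_mem_nhdsWithin.mono fun k hk => mem_Ioi.2 (sub_pos.2 hk)⟩
    exact (Continuous.tendsto' (by fun_prop) _ _ (sub_self 1)).mono_left nhdsWithin_le_nhds
  have hlog : Tendsto (fun k : ℝ => -log (1 - k) / 2) (𝓝[<] 1) atTop :=
    (tendsto_neg_atBot_atTop.comp (tendsto_log_nhdsGT_zero.comp hsub)).atTop_div_const two_pos
  refine tendsto_atTop_mono' _ ?_ hlog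
  filter_upwards [Ioo_mem_nhdsLT one_pos] with k hk
  exact neg_log_one_sub_div_two_le_ellipticK ((sq_lt_one_iff₀ hk.1.le).2 hk.2)

theorem bijOn_ellipticK : BijOn ellipticK (Ioo 0 1) (Ioi (π / 2)) := by
  refine ⟨fun k hk => ?_, strictMonoOn_ellipticK.injOn.mono Ioo_subset_Ico_self, fun y hy => ?_⟩
  · rw [← ellipticK_zero]
    exact strictMonoOn_ellipticK ⟨le_rfl, one_pos⟩ ⟨hk.1.le, hk.2⟩ hk.1
  · have hcont : ContinuousOn ellipticK (Ico 0 1) :=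
      continuousOn_ellipticK.mono fun k hk => (sq_lt_one_iff₀ hk.1).2 hk.2
    have hlim : 𝓝[<] (1 : ℝ) ≤ 𝓟 (Ico 0 1) := le_principal_iff.2 (Ico_mem_nhdsLT one_pos)
    obtain ⟨k, hk, rfl⟩ := isPreconnected_Ico.intermediate_value_Ici ⟨le_rfl, one_pos⟩ hlim hcont
      tendsto_ellipticK_atTop (ellipticK_zero.trans_le (le_of_lt hy))
    refine ⟨k, ⟨hk.1.lt_of_ne ?_, hk.2⟩, rfl⟩
    rintro rfl
    exact (mem_Ioi.1 hy).ne' ellipticK_zero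

theorem bijOn_sqrt_Ioo : BijOn sqrt (Ioo 0 1) (Ioo 0 1) :=
  InvOn.bijOn (f' := fun k => k ^ 2)
    ⟨fun _ ha => sq_sqrt ha.1.le, fun _ hk => sqrt_sq hk.1.le⟩
    (fun _ ha => ⟨sqrt_pos.2 ha.1, by simpa using sqrt_lt_sqrt ha.1.le ha.2⟩)
    fun _ hk => ⟨pow_pos hk.1 2, (sq_lt_one_iff₀ hk.1.le).2 hk.2⟩

theorem bijOn_ellipticK_sqrt : BijOn (fun a => ellipticK √a) (Ioo 0 1) (Ioi (π / 2)) :=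
  bijOn_ellipticK.comp bijOn_sqrt_Ioo

end EllipticIntegrals

section JacobiFunctions

variable {k : ℝ}

/-- Jacobi elliptic cosine with argument `u` and modulus `k`. -/
noncomputable def jacobiCn (u k : ℝ) : ℝ := cos (jacobiAm u k)

/-- Jacobi delta amplitude with argument `u` and modulus `k`, the derivative of `jacobiAm · k`. -/
noncomputable def jacobiDn (u k : ℝ) : ℝ := √(1 - k ^ 2 * jacobiSn u k ^ 2)

theorem jacobiAm_zero (hk : k ^ 2 < 1) : jacobiAm 0 k = 0 := by
  simpa only [ellipticF_zero] using jacobiAm_ellipticF hk 0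

theorem jacobiSn_zero (hk : k ^ 2 < 1) : jacobiSn 0 k = 0 := by
  rw [jacobiSn, jacobiAm_zero hk, sin_zero]

theorem jacobiCn_zero (hk : k ^ 2 < 1) : jacobiCn 0 k = 1 := by
  rw [jacobiCn, jacobiAm_zero hk, cos_zero]

theorem jacobiDn_pos (hk : k ^ 2 < 1) (u : ℝ) : 0 < jacobiDn u k :=
  sqrt_pos.2 (one_sub_sq_mul_sin_sq_pos hk _)

theorem abs_mul_jacobiSn_lt_one (hk : k ^ 2 < 1) (u : ℝ) : |k * jacobiSn u k| < 1 :=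
  abs_mul_sin_lt_one hk (jacobiAm u k)

theorem continuous_jacobiAm (hk : k ^ 2 < 1) : Continuous fun u => jacobiAm u k := by
  let e := (strictMono_ellipticF hk).orderIsoOfSurjective _ (ellipticF_bijective hk).2
  have he : (fun u => jacobiAm u k) = e.symm := funext fun u =>
    e.eq_symm_apply.2 (ellipticF_jacobiAm hk u)
  rw [he]
  exact e.symm.continuous

theorem hasDerivAt_jacobiAm (hk : k ^ 2 < 1) (u : ℝ) :
    HasDerivAt (fun u => jacobiAm u k) (jacobiDn u k) u := by
  have h := HasDerivAt.of_local_left_inverse (continuous_jacobiAm hk).continuousAt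
    (hasDerivAt_ellipticF hk (jacobiAm u k)) (one_div_pos.2 (jacobiDn_pos hk u)).ne'
    (Eventually.of_forall (ellipticF_jacobiAm hk))
  rwa [one_div, inv_inv] at h

theorem hasDerivAt_jacobiSn (hk : k ^ 2 < 1) (u : ℝ) :
    HasDerivAt (fun u => jacobiSn u k) (jacobiCn u k * jacobiDn u k) u :=
  (hasDerivAt_jacobiAm hk u).sin

theorem hasDerivAt_jacobiCn (hk : k ^ 2 < 1) (u : ℝ) :
    HasDerivAt (fun u => jacobiCn u k) (-jacobiSn u k * jacobiDn u k) u :=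
  (hasDerivAt_jacobiAm hk u).cos

theorem antiperiodic_jacobiSn (hk : k ^ 2 < 1) :
    Antiperiodic (fun u => jacobiSn u k) (2 * ellipticK k) := fun u => by
  have ham : jacobiAm (u + 2 * ellipticK k) k = jacobiAm u k + π := by
    apply (ellipticF_bijective hk).1
    simpa [ellipticF_jacobiAm hk] using (ellipticF_add_int_mul_pi hk (jacobiAm u k) 1).symm
  simp only [jacobiSn, ham, sin_add_pi]

theorem exists_int_mul_eq_of_jacobiCn_eq_one (hk : k ^ 2 < 1) {u : ℝ} (hu : jacobiCn u k = 1) :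
    ∃ n : ℤ, n * (4 * ellipticK k) = u := by
  obtain ⟨n, hn⟩ := (cos_eq_one_iff _).1 hu
  have hF := ellipticF_add_int_mul_pi hk 0 (n * 2)
  refine ⟨n, ?_⟩
  calc n * (4 * ellipticK k) = ellipticF (n * (2 * π)) k := by
        rw [ellipticF_zero, zero_add, zero_add] at hF
        push_cast at hF
        rw [← mul_assoc (n : ℝ) 2 π, hF]
        ring
    _ = u := by rw [hn, ellipticF_jacobiAm hk]

end JacobiFunctions

section PeriodicFunctions

variable {E : Type*} [NormedAddCommGroup E] [NormedSpace ℝ E] {x v : ℝ → E} {c : ℝ}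

theorem periodic_of_hasDerivAt (hx : ∀ t, HasDerivAt x (v t) t) (h : Periodic x c) :
    Periodic v c := fun t => by
  have hshift := (hx (t + c)).comp_add_const t c
  rw [h.funext] at hshift
  exact hshift.unique (hx t)

theorem antiperiodic_of_hasDerivAt (hx : ∀ t, HasDerivAt x (v t) t) (h : Antiperiodic x c) :
    Antiperiodic v c := fun t => by
  have hshift := (hx (t + c)).comp_add_const t c
  rw [h.funext] at hshift
  exact hshift.unique (hx t).neg

end PeriodicFunctions

theorem periodic_comp_add_const_iff {α β : Type*} [AddCommGroup α] {f : α → β} {a c : α} :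
    Periodic (fun t => f (t + a)) c ↔ Periodic f c :=
  ⟨fun h => by simpa only [sub_add_cancel] using h.sub_const a, fun h => h.add_const a⟩

theorem exists_eq_zero_of_antiperiodic {x : ℝ → ℝ} {c : ℝ} (hx : Continuous x)
    (h : Antiperiodic x c) : ∃ t, x t = 0 := by
  rcases le_total 0 (x 0) with h0 | h0
  · exact intermediate_value_univ c 0 hx ⟨by linarith [h.eq], h0⟩
  · exact intermediate_value_univ 0 c hx ⟨h0, by linarith [h.eq]⟩

section NewtonEquation

variable {E : Type*} [NormedAddCommGroup E] [NormedSpace ℝ E]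

/-- `x` solves Newton's equation `x'' = g(x)` on the whole line, with velocity `v = x'`. The
velocity is kept as data so that the equation is a first-order system for `(x, v)`. -/
structure IsNewtonSolution (g : E → E) (x v : ℝ → E) : Prop where
  hasDerivAt : ∀ t, HasDerivAt x (v t) t
  hasDerivAt_velocity : ∀ t, HasDerivAt v (g (x t)) t

namespace IsNewtonSolution

variable {g : E → E} {x v y w : ℝ → E}

protected theorem continuous (h : IsNewtonSolution g x v) : Continuous x :=
  continuous_iff_continuousAt.2 fun t => (h.hasDerivAt t).continuousAt

theorem comp_add_const (h : IsNewtonSolution g x v) (a : ℝ) :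
    IsNewtonSolution g (fun t => x (t + a)) (fun t => v (t + a)) :=
  ⟨fun t => (h.hasDerivAt (t + a)).comp_add_const t a,
    fun t => (h.hasDerivAt_velocity (t + a)).comp_add_const t a⟩

theorem const {p : E} (hp : g p = 0) : IsNewtonSolution g (fun _ => p) (fun _ => 0) :=
  ⟨fun t => hasDerivAt_const t p, fun t => by simpa only [hp] using hasDerivAt_const t (0 : E)⟩

theorem eq_of_initial_eq {K : NNReal} (hg : LipschitzWith K g) (hx : IsNewtonSolution g x v)
    (hy : IsNewtonSolution g y w) {t₀ : ℝ} (hpos : x t₀ = y t₀) (hvel : v t₀ = w t₀) :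
    x = y ∧ v = w := by
  have hfield : LipschitzWith (max 1 (K * 1)) fun p : E × E => (p.2, g p.1) :=
    LipschitzWith.prod_snd.prodMk (hg.comp LipschitzWith.prod_fst)
  have h : (fun t => (x t, v t)) = fun t => (y t, w t) :=
    ODE_solution_unique_univ (s := fun _ => univ) (t₀ := t₀) (fun _ => hfield.lipschitzOnWith)
      (fun t => ⟨(hx.hasDerivAt t).prodMk (hx.hasDerivAt_velocity t), trivial⟩)
      (fun t => ⟨(hy.hasDerivAt t).prodMk (hy.hasDerivAt_velocity t), trivial⟩)
      (Prod.ext hpos hvel)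
  exact ⟨funext fun t => congrArg Prod.fst (congrFun h t),
    funext fun t => congrArg Prod.snd (congrFun h t)⟩

theorem eq_const_of_rest {K : NNReal} (hg : LipschitzWith K g) (h : IsNewtonSolution g x v) {s : ℝ}
    (hforce : g (x s) = 0) (hvel : v s = 0) : (x = fun _ => x s) ∧ v = fun _ => 0 :=
  eq_of_initial_eq hg h (const hforce) rfl hvel

theorem energy_eq {g G x v : ℝ → ℝ} (hG : ∀ p, HasDerivAt G (g p) p)
    (h : IsNewtonSolution g x v) (s t : ℝ) :
    v s ^ 2 / 2 - G (x s) = v t ^ 2 / 2 - G (x t) := by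
  have hderiv (t : ℝ) : HasDerivAt (fun t => v t ^ 2 / 2 - G (x t)) 0 t :=
    ((((h.hasDerivAt_velocity t).pow 2).div_const 2).sub
      ((hG (x t)).comp t (h.hasDerivAt t))).congr_deriv (by rw [Nat.cast_ofNat]; ring)
  exact is_const_of_deriv_eq_zero (fun t => (hderiv t).differentiableAt)
    (fun t => (hderiv t).deriv) s t

end IsNewtonSolution

end NewtonEquation

section Pendulum

theorem lipschitzWith_const_mul_sin (c : ℝ) : LipschitzWith ‖c‖₊ fun u => c * sin u := by
  have h := (lipschitzWith_smul c).comp lipschitzWith_sin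
  rw [mul_one] at h
  exact h

theorem IsNewtonSolution.velocity_sq_lt_of_periodic {c T t₀ : ℝ} {x v : ℝ → ℝ}
    (h : IsNewtonSolution (fun u => -c * sin u) x v) (hT : 0 < T) (hper : Periodic x T)
    (hx : x t₀ = 0) (hv : v t₀ ≠ 0) : v t₀ ^ 2 < 4 * c := by
  obtain ⟨s, -, hs⟩ : ∃ s ∈ Ioo t₀ (t₀ + T), v s = 0 :=
    exists_hasDerivAt_eq_zero (lt_add_of_pos_right t₀ hT) h.continuous.continuousOn
      (hper t₀).symm fun t _ => h.hasDerivAt t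
  have henergy : v t₀ ^ 2 = 2 * c * (1 - cos (x s)) := by
    have := h.energy_eq (G := fun u => c * cos u)
      (fun u => ((hasDerivAt_cos u).const_mul c).congr_deriv (by ring)) t₀ s
    rw [hx, hs, cos_zero] at this
    linear_combination 2 * this
  have hturn : -1 < cos (x s) := by
    refine (neg_one_le_cos _).lt_of_ne fun hcos => hv ?_
    have hsin : sin (x s) = 0 := sin_eq_zero_iff_cos_eq.2 (.inr hcos.symm)
    exact congrFun (h.eq_const_of_rest (lipschitzWith_const_mul_sin _) (by simp [hsin]) hs).2 t₀
  have hc : 0 < c := by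
    have hprod : 0 < 2 * c * (1 - cos (x s)) := henergy ▸ sq_pos_of_ne_zero hv
    linarith [pos_of_mul_pos_left hprod (sub_nonneg.2 (cos_le_one _))]
  calc v t₀ ^ 2 = 2 * c * (1 - cos (x s)) := henergy
    _ < 2 * c * 2 := by gcongr; linarith
    _ = 4 * c := by ring

/-- The libration of the pendulum `x'' = -ω² sin x` that starts at `x 0 = 0` with velocity
`x' 0 = 2 k ω`; the modulus `k` is the sine of half the amplitude. -/
noncomputable def pendulumLibration (ω k t : ℝ) : ℝ := 2 * arcsin (k * jacobiSn (ω * t) k)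

variable {ω k : ℝ}

theorem pendulumLibration_zero (hk : k ^ 2 < 1) (ω : ℝ) : pendulumLibration ω k 0 = 0 := by
  simp [pendulumLibration, jacobiSn_zero hk]

theorem sin_pendulumLibration (hk : k ^ 2 < 1) (ω t : ℝ) :
    sin (pendulumLibration ω k t) = 2 * k * jacobiSn (ω * t) k * jacobiDn (ω * t) k := by
  obtain ⟨hlo, hhi⟩ := abs_lt.1 (abs_mul_jacobiSn_lt_one hk (ω * t))
  rw [pendulumLibration, sin_two_mul, cos_arcsin, sin_arcsin hlo.le hhi.le, mul_pow, jacobiDn]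
  ring

theorem isNewtonSolution_pendulumLibration (hk : k ^ 2 < 1) (ω : ℝ) :
    IsNewtonSolution (fun u => -ω ^ 2 * sin u) (pendulumLibration ω k)
      (fun t => 2 * k * ω * jacobiCn (ω * t) k) := by
  have hscale (t : ℝ) : HasDerivAt (fun t => ω * t) ω t := hasDerivAt_const_mul ω
  refine ⟨fun t => ?_, fun t => ?_⟩
  · obtain ⟨hlo, hhi⟩ := abs_lt.1 (abs_mul_jacobiSn_lt_one hk (ω * t))
    have hsn := ((hasDerivAt_jacobiSn hk (ω * t)).comp t (hscale t)).const_mul k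
    refine (((hasDerivAt_arcsin hlo.ne' hhi.ne).comp t hsn).const_mul 2).congr_deriv ?_
    have hdn := (jacobiDn_pos hk (ω * t)).ne'
    rw [mul_pow, ← jacobiDn]
    field_simp
  · refine (((hasDerivAt_jacobiCn hk (ω * t)).comp t (hscale t)).const_mul
      (2 * k * ω)).congr_deriv ?_
    rw [sin_pendulumLibration hk]
    ring

theorem antiperiodic_pendulumLibration (hω : ω ≠ 0) (hk : k ^ 2 < 1) :
    Antiperiodic (pendulumLibration ω k) (2 * ellipticK k / ω) := fun t => by
  have hsn : jacobiSn (ω * t + 2 * ellipticK k) k = -jacobiSn (ω * t) k :=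
    antiperiodic_jacobiSn hk (ω * t)
  rw [pendulumLibration, mul_add, mul_div_cancel₀ _ hω, hsn, mul_neg, arcsin_neg, mul_neg,
    pendulumLibration]

theorem le_period_pendulumLibration {T : ℝ} (hω : 0 < ω) (hk₀ : k ≠ 0) (hk : k ^ 2 < 1)
    (hT : 0 < T) (hper : Periodic (pendulumLibration ω k) T) : 4 * ellipticK k / ω ≤ T := by
  have hvel := (periodic_of_hasDerivAt (isNewtonSolution_pendulumLibration hk ω).hasDerivAt hper).eq
  rw [mul_zero, jacobiCn_zero hk] at hvel
  have hcn : jacobiCn (ω * T) k = 1 :=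
    mul_left_cancel₀ (mul_ne_zero (mul_ne_zero two_ne_zero hk₀) hω.ne') hvel
  obtain ⟨n, hn⟩ := exists_int_mul_eq_of_jacobiCn_eq_one hk hcn
  have hK : 0 < 4 * ellipticK k := mul_pos four_pos (ellipticK_pos hk)
  have hnpos : (0 : ℝ) < n := pos_of_mul_pos_left (hn ▸ mul_pos hω hT) hK.le
  rw [div_le_iff₀' hω, ← hn]
  exact le_mul_of_one_le_left hK.le (by exact_mod_cast Int.cast_pos.1 hnpos)

theorem isLeast_period_pendulumLibration (hω : 0 < ω) (hk₀ : k ≠ 0) (hk : k ^ 2 < 1) :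
    IsLeast {T | 0 < T ∧ Periodic (pendulumLibration ω k) T} (4 * ellipticK k / ω) := by
  refine ⟨⟨div_pos (mul_pos four_pos (ellipticK_pos hk)) hω, ?_⟩,
    fun T hT => le_period_pendulumLibration hω hk₀ hk hT.1 hT.2⟩
  rw [show 4 * ellipticK k / ω = 2 * (2 * ellipticK k / ω) by ring]
  exact (antiperiodic_pendulumLibration hω.ne' hk).periodic_two_mul

theorem IsNewtonSolution.eq_pendulumLibration {x v : ℝ → ℝ}
    (h : IsNewtonSolution (fun u => -ω ^ 2 * sin u) x v) {t₀ : ℝ} (hx : x t₀ = 0)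
    (hv : v t₀ ^ 2 < 4 * ω ^ 2) :
    x = fun t => pendulumLibration ω (v t₀ / (2 * ω)) (t + -t₀) := by
  have hω : ω ≠ 0 := by
    rintro rfl
    linarith [sq_nonneg (v t₀)]
  have hk : (v t₀ / (2 * ω)) ^ 2 < 1 := by
    rw [div_pow, mul_pow, div_lt_one (by positivity)]
    linarith
  refine (IsNewtonSolution.eq_of_initial_eq (lipschitzWith_const_mul_sin _) h
    ((isNewtonSolution_pendulumLibration hk ω).comp_add_const (-t₀)) (t₀ := t₀) ?_ ?_).1
  · rw [hx, add_neg_cancel, pendulumLibration_zero hk]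
  · rw [add_neg_cancel, mul_zero, jacobiCn_zero hk]
    field_simp

end Pendulum

section DelayEquation

variable {f x v : ℝ → ℝ}

protected theorem IsSolutionDDE.continuous (hx : IsSolutionDDE f x) : Continuous x :=
  continuous_iff_continuousAt.2 fun t => (hx t).continuousAt

theorem IsSolutionDDE.isNewtonSolution (hx : IsSolutionDDE f x) (hf : Continuous f)
    (hodd : Function.Odd f) (hanti : Antiperiodic x 1) :
    IsNewtonSolution (fun u => -(2 * f u)) x (fun t => -∫ s in (0 : ℝ)..1, f (x (t - s))) := by
  refine ⟨hx, fun t => ?_⟩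
  have hfx : Continuous fun s => f (x s) := hf.comp hx.continuous
  have hprim (t : ℝ) : HasDerivAt (fun t => ∫ s in (0 : ℝ)..t, f (x s)) (f (x t)) t :=
    (hfx.integral_hasStrictDerivAt 0 t).hasDerivAt
  have hwindow : (fun t => -∫ s in (0 : ℝ)..1, f (x (t - s))) =
      fun t => -((∫ s in (0 : ℝ)..t, f (x s)) - ∫ s in (0 : ℝ)..(t - 1), f (x s)) := by
    funext t
    rw [intervalIntegral.integral_comp_sub_left (fun s => f (x s)), sub_zero,
      intervalIntegral.integral_interval_sub_left (hfx.intervalIntegrable _ _)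
        (hfx.intervalIntegrable _ _)]
  rw [hwindow]
  refine ((hprim t).sub ((hprim (t - 1)).comp_sub_const t 1)).neg.congr_deriv ?_
  rw [hanti.sub_eq, hodd]
  ring

theorem IsNewtonSolution.isSolutionDDE (h : IsNewtonSolution (fun u => -(2 * f u)) x v)
    (hf : Continuous f) (hanti : Antiperiodic x 1) : IsSolutionDDE f x := fun t => by
  have hfx : Continuous fun s => f (x s) := hf.comp h.continuous
  have hvel : v (t - 1) = -v t := (antiperiodic_of_hasDerivAt h.hasDerivAt hanti).sub_eq t
  have hint := intervalIntegral.integral_eq_sub_of_hasDerivAt (a := t - 1) (b := t)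
    (fun s _ => h.hasDerivAt_velocity s) ((hfx.const_mul 2).neg.intervalIntegrable _ _)
  rw [intervalIntegral.integral_neg, intervalIntegral.integral_const_mul, hvel] at hint
  refine (h.hasDerivAt t).congr_deriv ?_
  rw [intervalIntegral.integral_comp_sub_left (fun s => f (x s)), sub_zero]
  linarith

namespace IsSSPS

theorem antiperiodic (h : IsSSPS f x) : Antiperiodic x 1 := fun t => by
  have := h.symmetric (t + 1)
  rw [add_sub_cancel_right] at this
  linarith

theorem ne_const (h : IsSSPS f x) (c : ℝ) : x ≠ fun _ => c := by
  rintro rfl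
  have := h.minimalPeriod.2 ⟨one_pos, fun _ => rfl⟩
  norm_num at this

end IsSSPS

end DelayEquation

section SineFeedback

variable {r k : ℝ}

theorem two_mul_div_eq_one_iff {K ω : ℝ} (hK : K ≠ 0) : 2 * K / ω = 1 ↔ K = ω / 2 := by
  rw [eq_div_iff two_ne_zero, mul_comm K]
  refine ⟨eq_of_div_eq_one, fun h => ?_⟩
  rw [← h, div_self (mul_ne_zero two_ne_zero hK)]

theorem pi_div_two_lt_sqrt_div_two_iff : π / 2 < √(2 * r) / 2 ↔ π ^ 2 / 2 < r := by
  rw [div_lt_div_iff_of_pos_right two_pos, lt_sqrt pi_pos.le, div_lt_iff₀' two_pos]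

theorem isSSPS_pendulumLibration (hk : k ∈ Ioo 0 1) (hK : ellipticK k = √(2 * r) / 2) :
    IsSSPS (fun u => r * sin u) (pendulumLibration √(2 * r) k) := by
  have hk1 : k ^ 2 < 1 := (sq_lt_one_iff₀ hk.1.le).2 hk.2
  have hω : 0 < √(2 * r) := by linarith [ellipticK_pos hk1]
  have hω2 : √(2 * r) ^ 2 = 2 * r := sq_sqrt (sqrt_pos.1 hω).le
  have hanti : Antiperiodic (pendulumLibration √(2 * r) k) 1 := by
    have h := antiperiodic_pendulumLibration hω.ne' hk1
    rwa [hK, mul_div_cancel₀ _ two_ne_zero, div_self hω.ne'] at h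
  refine ⟨?_, ?_, fun t => ?_⟩
  · have h := isNewtonSolution_pendulumLibration hk1 √(2 * r)
    simp only [hω2, neg_mul, mul_assoc] at h
    exact h.isSolutionDDE (f := fun u => r * sin u) (by fun_prop) hanti
  · have h := isLeast_period_pendulumLibration hω hk.1.ne' hk1
    rwa [hK, show 4 * (√(2 * r) / 2) / √(2 * r) = 2 by field_simp; norm_num] at h
  · rw [hanti.sub_eq, add_neg_cancel]

namespace IsSSPS

variable {x v : ℝ → ℝ}

theorem exists_isNewtonSolution (h : IsSSPS (fun u => r * sin u) x) :
    ∃ v, IsNewtonSolution (fun u => -(2 * r) * sin u) x v := by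
  have hodd : Function.Odd fun u => r * sin u := fun u => by simp only [sin_neg, mul_neg]
  have hx := h.isSolution.isNewtonSolution (by fun_prop) hodd h.antiperiodic
  exact ⟨_, by simpa only [neg_mul, mul_assoc] using hx⟩

theorem exists_eq_zero_velocity_pos (h : IsSSPS (fun u => r * sin u) x)
    (hx : IsNewtonSolution (fun u => -(2 * r) * sin u) x v) : ∃ t, x t = 0 ∧ 0 < v t := by
  obtain ⟨t, ht⟩ := exists_eq_zero_of_antiperiodic hx.continuous h.antiperiodic
  have hvt : v t ≠ 0 := fun hvt => h.ne_const _
    (hx.eq_const_of_rest (lipschitzWith_const_mul_sin _) (by simp [ht]) hvt).1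
  rcases hvt.lt_or_gt with hneg | hpos
  · refine ⟨t + 1, by rw [h.antiperiodic, ht, neg_zero], ?_⟩
    rw [antiperiodic_of_hasDerivAt hx.hasDerivAt h.antiperiodic]
    exact neg_pos.2 hneg
  · exact ⟨t, ht, hpos⟩

theorem exists_eq_pendulumLibration (h : IsSSPS (fun u => r * sin u) x) :
    ∃ k ∈ Ioo 0 1, ellipticK k = √(2 * r) / 2 ∧
      ∃ t₀, x = fun t => pendulumLibration √(2 * r) k (t + t₀) := by
  obtain ⟨v, hx⟩ := h.exists_isNewtonSolution
  obtain ⟨t, hxt, hvt⟩ := h.exists_eq_zero_velocity_pos hx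
  have hspeed : v t ^ 2 < 4 * (2 * r) :=
    hx.velocity_sq_lt_of_periodic two_pos h.minimalPeriod.1.2 hxt hvt.ne'
  have hr : 0 < 2 * r := by linarith [pow_pos hvt 2]
  have hω : 0 < √(2 * r) := sqrt_pos.2 hr
  have hω2 : √(2 * r) ^ 2 = 2 * r := sq_sqrt hr.le
  rw [← hω2] at hx hspeed
  set k := v t / (2 * √(2 * r)) with hkdef
  have hk0 : 0 < k := by positivity
  have hk1 : k ^ 2 < 1 := by
    rw [hkdef, div_pow, mul_pow, div_lt_one (by positivity)]
    linarith
  have heq : x = fun s => pendulumLibration √(2 * r) k (s + -t) :=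
    hx.eq_pendulumLibration hxt hspeed
  have hperiod : 4 * ellipticK k / √(2 * r) = 2 := by
    have hmin := h.minimalPeriod
    simp only [heq, periodic_comp_add_const_iff] at hmin
    exact (isLeast_period_pendulumLibration hω hk0.ne' hk1).unique hmin
  refine ⟨k, ⟨hk0, (sq_lt_one_iff₀ hk0.le).1 hk1⟩, ?_, -t, heq⟩
  rw [div_eq_iff hω.ne'] at hperiod
  linarith

end IsSSPS

end SineFeedback

theorem theorem4_general (r : ℝ) :
    ((∃ x : ℝ → ℝ, IsSSPS (fun u => r * Real.sin u) x) ↔ Real.pi ^ 2 / 2 < r) ∧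
    (Real.pi ^ 2 / 2 < r →
      (∃! a : ℝ, a ∈ Set.Ioo (0 : ℝ) 1 ∧
        2 * ellipticK (Real.sqrt a) / Real.sqrt (2 * r) = 1) ∧
      ∀ a ∈ Set.Ioo (0 : ℝ) 1, 2 * ellipticK (Real.sqrt a) / Real.sqrt (2 * r) = 1 →
        IsSSPS (fun u => r * Real.sin u) (fun t =>
          2 * Real.arcsin (Real.sqrt a * jacobiSn (Real.sqrt (2 * r) * t) (Real.sqrt a))) ∧
        ∀ x : ℝ → ℝ, IsSSPS (fun u => r * Real.sin u) x →
          ∃ t₀ : ℝ, ∀ t : ℝ, x t =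
            2 * Real.arcsin
              (Real.sqrt a * jacobiSn (Real.sqrt (2 * r) * (t + t₀)) (Real.sqrt a))) := by
  have hmod {a : ℝ} (ha : a ∈ Ioo 0 1) :
      2 * ellipticK √a / √(2 * r) = 1 ↔ ellipticK √a = √(2 * r) / 2 :=
    two_mul_div_eq_one_iff (pi_div_two_pos.trans (bijOn_ellipticK_sqrt.mapsTo ha)).ne'
  have hexists (h : π ^ 2 / 2 < r) : ∃ a ∈ Ioo 0 1, ellipticK √a = √(2 * r) / 2 :=
    bijOn_ellipticK_sqrt.surjOn (pi_div_two_lt_sqrt_div_two_iff.2 h)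
  refine ⟨⟨fun ⟨x, hx⟩ => ?_, fun h => ?_⟩, fun h => ⟨?_, fun a ha hK => ⟨?_, fun x hx => ?_⟩⟩⟩
  · obtain ⟨k, hk, hK, -⟩ := hx.exists_eq_pendulumLibration
    exact pi_div_two_lt_sqrt_div_two_iff.1 (hK ▸ bijOn_ellipticK.mapsTo hk)
  · obtain ⟨a, ha, hK⟩ := hexists h
    exact ⟨_, isSSPS_pendulumLibration (bijOn_sqrt_Ioo.mapsTo ha) hK⟩
  · obtain ⟨a, ha, hK⟩ := hexists h
    exact ⟨a, ⟨ha, (hmod ha).2 hK⟩, fun b ⟨hb, hKb⟩ =>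
      bijOn_ellipticK_sqrt.injOn hb ha (((hmod hb).1 hKb).trans hK.symm)⟩
  · exact isSSPS_pendulumLibration (bijOn_sqrt_Ioo.mapsTo ha) ((hmod ha).1 hK)
  · obtain ⟨k, hk, hKk, t₀, rfl⟩ := hx.exists_eq_pendulumLibration
    obtain rfl : k = √a := bijOn_ellipticK.injOn hk (bijOn_sqrt_Ioo.mapsTo ha)
      (hKk.trans ((hmod ha).1 hK).symm)
    exact ⟨t₀, fun _ => rfl⟩

theorem theorem4 (r : ℝ) (hr : 0 < r) :
    ((∃ x : ℝ → ℝ, IsSSPS (fun u => r * Real.sin u) x) ↔ Real.pi ^ 2 / 2 < r) ∧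
    (Real.pi ^ 2 / 2 < r →
      (∃! a : ℝ, a ∈ Set.Ioo (0 : ℝ) 1 ∧
        2 * ellipticK (Real.sqrt a) / Real.sqrt (2 * r) = 1) ∧
      ∀ a ∈ Set.Ioo (0 : ℝ) 1, 2 * ellipticK (Real.sqrt a) / Real.sqrt (2 * r) = 1 →
        IsSSPS (fun u => r * Real.sin u) (fun t =>
          2 * Real.arcsin (Real.sqrt a * jacobiSn (Real.sqrt (2 * r) * t) (Real.sqrt a))) ∧
        ∀ x : ℝ → ℝ, IsSSPS (fun u => r * Real.sin u) x →
          ∃ t₀ : ℝ, ∀ t : ℝ, x t =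
            2 * Real.arcsin
              (Real.sqrt a * jacobiSn (Real.sqrt (2 * r) * (t + t₀)) (Real.sqrt a))) :=
  theorem4_general r
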